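/- **Types.** Let $\mathcal S$ be a set of sorts. Types are generated from sorts by the binary constructor $T\to U$ (associating to the right). The arity of a sort is $0$ and the arity of $T\to U$ is $1$ plus the arity of $U$. Write $(T\to U)\rhd_l T$ and $(T\to U)\rhd_r U$. A strict ordering $>$ on types (irreflexive and transitive, with reflexive closure $\ge$) is *admissible* if: (i) ${\rhd_r}\subseteq{>}$; (ii) $({>}\cup{\rhd_l})^+$ is well-founded (no infinite descending sequence); (iii) if $T\to U>V$, then $U\ge V$, or $V=T\to U'$ with $U>U'$. **Terms.** Let $\mathcal X$ be a set of variables, each $x$ with a type $\tau(x)$, infinitely many of each type, and $\mathcal F$ a set (finite or infinite) of function symbols disjoint from $\mathcal X$, each $f$ with a type and an arity $n$ that is at most the arity of its type. Terms (taken up to type-preserving renaming of bound variables) are: variables $x:\tau(x)$; $f(t_1,\dots,t_n):U$ if $f$ has arity $n$ and type $T_1\to\dots\to T_n\to U$ and $t_i:T_i$; $tu:V$ if $t:U\to V$ and $u:U$; $\lambda x\,t:\tau(x)\to T$ if $t:T$. Write $\tau(t)$ for the type of $t$, $FV(t)$ for its set of free variables and $t_x^u$ for capture-avoiding substitution of $u$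 for $x$ in $t$. **Statuses.** For a relation $\succ$ on terms and finite sequences $\vec t,\vec u$ of terms: $\vec t\succ_{\mathrm{mul}}\vec u$ if the multiset of $\vec t$ is related to that of $\vec u$ by the transitive closure of the relation $M+\{x\}\to M+\{y_1,\dots,y_k\}$ ($k\ge0$, $x\succ y_i$ for all $i$); $\vec t\succ_{\mathrm{lex}(n)}\vec u$ if there is $j\in\{1,\dots,n\}$ such that $t_j$ and $u_j$ exist, $t_j\succ u_j$, and $t_i=u_i$ for all $i<j$. **Data.** Let $>$ be an admissible ordering on types; let $\ge_{\mathcal F}$ be a quasi-ordering on $\mathcal F$ whose strict part $>_{\mathcal F}$ is well-founded, with associated equivalence $\simeq_{\mathcal F}$; and for every $f\in\mathcal F$ let $\mathrm{stat}(f)\in\{\mathrm{mul}\}\cup\{\mathrm{lex}(n)\mid n\ge2\}$, equal for $\simeq_{\mathcal F}$-equivalent symbols. **Core computability path relation.** The relations $>^X$ on terms, for all finite sets $X$ of variables, are defined simultaneously as the smallest relations closed under the rules below. Here $\ge^X$ is the reflexive closure of $>^X$; $t>^X_\tau u$ means $t>^Xu$ and $\tau(t)\ge\tau(u)$; $\ge^X_\tau$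 is the reflexive closure of $>^X_\tau$; a superscript $\emptyset$ is omitted; and "$z$ fresh" means that the variable $z$ is not in $FV(l)\cup X\cup FV(r)$, where $l>^Xr$ is the conclusion of the rule. 1. $f(\vec t)>^Xv$ if $t_i\ge_\tau v$ for some $i$. 2. $f(\vec t)>^Xg(\vec u)$ if $f\simeq_{\mathcal F}g$, $f(\vec t)>^Xu_i$ for all $i$, and $\vec t\,(>_\tau)_{\mathrm{stat}(f)}\,\vec u$. 3. $f(\vec t)>^Xg(\vec u)$ if $f>_{\mathcal F}g$ and $f(\vec t)>^Xu_i$ for all $i$. 4. $f(\vec t)>^Xuv$ if $f(\vec t)>^Xu$ and $f(\vec t)>^Xv$. 5. $f(\vec t)>^X\lambda y\,v$ if $f(\vec t)>^{X\cup\{z\}}v_y^z$ with $\tau(z)=\tau(y)$ and $z$ fresh. 6. $f(\vec t)>^Xy$ if $y\in X$. 7. $tu>^Xv$ if $t\ge^Xv$ or $u\ge^X_\tau v$. 8. $tu>^Xt'u'$ if either $t=t'$ and $u>^Xu'$, or, for both $v=t'$ and $v=u'$, at least one of $t>^X_\tau v$, $u\ge^X_\tau v$, $tu>^X_\tau v$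 holds. 9. $tu>^X\lambda y\,v$ if $tu>^Xv_y^z$ with $\tau(z)=\tau(y)$ and $z$ fresh. 10. $tu>^Xy$ if $y\in X$. 11. $(\lambda x\,t)u>^Xv$ if $t_x^u\ge^Xv$. 12. $\lambda x\,t>^Xv$ if $t_x^z\ge^X_\tau v$ with $\tau(z)=\tau(x)$ and $z$ fresh. 13. $\lambda x\,t>^X\lambda y\,v$ if $t_x^z>^Xv_y^z$ with $\tau(x)=\tau(y)=\tau(z)$ and $z$ fresh. 14. $\lambda x\,t>^X\lambda y\,v$ if $\lambda x\,t>^Xv_y^z$ with $\tau(x)\ne\tau(y)=\tau(z)$ and $z$ fresh. 15. $\lambda x\,t>^Xy$ if $y\in X$. 16. $\lambda x(tx)>^Xv$ if $t\ge^Xv$ and $x\notin FV(t)$. **Theorem.** For all such data, the core computability path relation $>_\tau$ (that is, $>^\emptyset_\tau$) is well-founded on terms: there is no infinite sequence $t_0>_\tau t_1>_\tau t_2>_\tau\cdots$. -/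

import Mathlib

namespace CPO

universe u v w

/-! ## Simple types -/

/-- Simple types over a set `𝒮` of sorts. -/
inductive Ty (𝒮 : Type u) : Type u
  | base : 𝒮 → Ty 𝒮
  | arrow : Ty 𝒮 → Ty 𝒮 → Ty 𝒮

namespace Ty

variable {𝒮 : Type u}

/-- The arity of a type: a sort has arity `0`, and `T ⟶ U` has arity `1` plus the arity of `U`. -/
def arity : Ty 𝒮 → ℕ
  | base _ => 0
  | arrow _ U => 1 + arity U

/-- `arrows [T₁, …, Tₙ] U` is the type `T₁ ⟶ … ⟶ Tₙ ⟶ U`. -/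
def arrows : List (Ty 𝒮) → Ty 𝒮 → Ty 𝒮
  | [], U => U
  | T :: Ts, U => arrow T (arrows Ts U)

/-- The relation `T ⟶ U ⊳ₗ T`. -/
inductive LeftSub : Ty 𝒮 → Ty 𝒮 → Prop
  | intro (T U : Ty 𝒮) : LeftSub (arrow T U) T

/-- The relation `T ⟶ U ⊳ᵣ U`. -/
inductive RightSub : Ty 𝒮 → Ty 𝒮 → Prop
  | intro (T U : Ty 𝒮) : RightSub (arrow T U) U

end Ty

/-- Admissible (strict) orderings on types; `tyGt T U` is read `T > U`. -/
structure Admissible {𝒮 : Type u} (tyGt : Ty 𝒮 → Ty 𝒮 → Prop) : Prop where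
  irrefl : ∀ T, ¬ tyGt T T
  trans : ∀ T U V, tyGt T U → tyGt U V → tyGt T V
  right_subterm : ∀ T U, Ty.RightSub T U → tyGt T U
  /-- The relation `(> ∪ ⊳ₗ)⁺` has no infinite descending chain. -/
  wf : WellFounded fun U T : Ty 𝒮 =>
    Relation.TransGen (fun A B => tyGt A B ∨ Ty.LeftSub A B) T U
  arrow : ∀ T U V, tyGt (Ty.arrow T U) V →
    Relation.ReflGen tyGt U V ∨ ∃ U', V = Ty.arrow T U' ∧ tyGt U U'

/-! ## Signatures and terms -/

/-- Typed variables (infinitely many of each type) and typed function symbols of fixed arity. -/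
structure Signature (𝒮 : Type u) (ℱ : Type v) (𝒳 : Type w) where
  varTy : 𝒳 → Ty 𝒮
  infinite_varTy : ∀ T, {x | varTy x = T}.Infinite
  funTy : ℱ → Ty 𝒮
  ar : ℱ → ℕ
  ar_le : ∀ f, ar f ≤ (funTy f).arity

/-- Raw terms up to `α`-equivalence, in locally nameless form: free variables are the named
variables `x : 𝒳`, bound variables are de Bruijn indices, and an abstraction `lam A b` carries the
type `A` of its bound variable. Equality of raw terms is `α`-equivalence of the terms that they
represent. A symbol `f` always comes with exactly `ar f` arguments. -/
inductive PreTerm {𝒮 : Type u} {ℱ : Type v} {𝒳 : Type w} (Sg : Signature 𝒮 ℱ 𝒳) :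
    Type (max u v w)
  | bvar : ℕ → PreTerm Sg
  | fvar : 𝒳 → PreTerm Sg
  | fn : (f : ℱ) → (Fin (Sg.ar f) → PreTerm Sg) → PreTerm Sg
  | app : PreTerm Sg → PreTerm Sg → PreTerm Sg
  | lam : Ty 𝒮 → PreTerm Sg → PreTerm Sg

namespace PreTerm

variable {𝒮 : Type u} {ℱ : Type v} {𝒳 : Type w} {Sg : Signature 𝒮 ℱ 𝒳}

/-- The finite set of free variables. -/
def fv [DecidableEq 𝒳] : PreTerm Sg → Finset 𝒳
  | bvar _ => ∅
  | fvar x => {x}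
  | fn _ ts => Finset.univ.biUnion fun i => fv (ts i)
  | app t u => fv t ∪ fv u
  | lam _ b => fv b

/-- Replace the bound variable of index `k` by `u`. -/
def instAt (u : PreTerm Sg) : ℕ → PreTerm Sg → PreTerm Sg
  | k, bvar i => if i = k then u else bvar i
  | _, fvar x => fvar x
  | k, fn f ts => fn f fun i => instAt u k (ts i)
  | k, app s t => app (instAt u k s) (instAt u k t)
  | k, lam A b => lam A (instAt u (k + 1) b)

/-- If `lam A b` represents `λ x t`, then `inst b u` represents the capture-avoiding substitution
instance of `t` where `x` is replaced by `u`. -/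
def inst (b u : PreTerm Sg) : PreTerm Sg := instAt u 0 b

/-- Typing; `Γ` lists the types of the bound variables in scope, innermost first. -/
inductive HasType : List (Ty 𝒮) → PreTerm Sg → Ty 𝒮 → Prop
  | bvar {Γ : List (Ty 𝒮)} {i : ℕ} {T : Ty 𝒮} : Γ[i]? = some T → HasType Γ (bvar i) T
  | fvar {Γ : List (Ty 𝒮)} (x : 𝒳) : HasType Γ (fvar x) (Sg.varTy x)
  | fn {Γ : List (Ty 𝒮)} {f : ℱ} {ts : Fin (Sg.ar f) → PreTerm Sg}
      {Ts : Fin (Sg.ar f) → Ty 𝒮} {U : Ty 𝒮} :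
      Sg.funTy f = Ty.arrows (List.ofFn Ts) U →
      (∀ i, HasType Γ (ts i) (Ts i)) → HasType Γ (fn f ts) U
  | app {Γ : List (Ty 𝒮)} {t u : PreTerm Sg} {U V : Ty 𝒮} :
      HasType Γ t (Ty.arrow U V) → HasType Γ u U → HasType Γ (app t u) V
  | lam {Γ : List (Ty 𝒮)} {A B : Ty 𝒮} {b : PreTerm Sg} :
      HasType (A :: Γ) b B → HasType Γ (lam A b) (Ty.arrow A B)

end PreTerm

/-- The set of (well-typed) terms: raw terms that have a type and no dangling bound variable. -/
def Term {𝒮 : Type u} {ℱ : Type v} {𝒳 : Type w} (Sg : Signature 𝒮 ℱ 𝒳) : Type (max u v w) :=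
  {t : PreTerm Sg // ∃ T, PreTerm.HasType [] t T}

/-! ## Statuses -/

inductive Status
  | mul : Status
  | lex (n : ℕ) (hn : 2 ≤ n) : Status

section StatusExtension

variable {α : Type u}

/-- One multiset step: an element `x` of `M` is replaced by finitely many elements smaller
than `x`. -/
def MulStep (r : α → α → Prop) (M N : Multiset α) : Prop :=
  ∃ (P : Multiset α) (x : α) (Q : Multiset α), M = P + {x} ∧ N = P + Q ∧ ∀ y ∈ Q, r x y

/-- The extension of `r` to argument sequences given by a status. For `lex n`, there is a (0-based)
position `j < n` that exists in both sequences, where the sequences decrease and before which they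
agree. -/
def StatusExt (r : α → α → Prop) : Status → List α → List α → Prop
  | Status.mul, ts, us => Relation.TransGen (MulStep r) (ts : Multiset α) (us : Multiset α)
  | Status.lex n _, ts, us =>
      ∃ j < n, ∃ a b, ts[j]? = some a ∧ us[j]? = some b ∧ r a b ∧ ∀ i < j, ts[i]? = us[i]?

theorem StatusExt.mono {r s : α → α → Prop} (h : ∀ a b, r a b → s a b) {st : Status}
    {ts us : List α} (H : StatusExt r st ts us) : StatusExt s st ts us := by
  cases st with
  | mul =>
    have hs : ∀ M N : Multiset α, MulStep r M N → MulStep s M N :=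
      fun _ _ ⟨P, x, Q, h1, h2, h3⟩ => ⟨P, x, Q, h1, h2, fun y hy => h _ _ (h3 y hy)⟩
    simp only [StatusExt] at H ⊢
    exact Relation.TransGen.mono (fun M N h => hs M N h) _ _ H
  | lex n hn =>
    obtain ⟨j, hj, a, b, h1, h2, h3, h4⟩ := H
    exact ⟨j, hj, a, b, h1, h2, h _ _ h3, h4⟩

end StatusExtension

/-! ## The core computability path relation -/

section Core

variable {𝒮 : Type u} {ℱ : Type v} {𝒳 : Type w} {Sg : Signature 𝒮 ℱ 𝒳}

/-- For a family `R X` of relations, `Tau tyGt R X` is the relation `(R X)_τ`: it holds for `t, u`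
if `R X t u` and the type of `t` is greater than or equal to the type of `u`. -/
def Tau (tyGt : Ty 𝒮 → Ty 𝒮 → Prop) (R : Finset 𝒳 → PreTerm Sg → PreTerm Sg → Prop)
    (X : Finset 𝒳) (t u : PreTerm Sg) : Prop :=
  R X t u ∧ ∃ T U, PreTerm.HasType [] t T ∧ PreTerm.HasType [] u U ∧ Relation.ReflGen tyGt T U

/-- `AppGt tyGt R X t u v` is the auxiliary comparison of the application `t u` with a component
`v` of the right-hand side application. -/
def AppGt (tyGt : Ty 𝒮 → Ty 𝒮 → Prop) (R : Finset 𝒳 → PreTerm Sg → PreTerm Sg → Prop)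
    (X : Finset 𝒳) (t u v : PreTerm Sg) : Prop :=
  Tau tyGt R X t v ∨ Relation.ReflGen (Tau tyGt R X) u v ∨ Tau tyGt R X (PreTerm.app t u) v

theorem Tau.mono {tyGt : Ty 𝒮 → Ty 𝒮 → Prop}
    {R R' : Finset 𝒳 → PreTerm Sg → PreTerm Sg → Prop}
    (h : ∀ X t u, R X t u → R' X t u) {X : Finset 𝒳} (t u : PreTerm Sg)
    (H : Tau tyGt R X t u) : Tau tyGt R' X t u :=
  ⟨h _ _ _ H.1, H.2⟩

variable [DecidableEq 𝒳]

/-- `z` is fresh with respect to the comparison of `t` and `u` with parameter `X`. -/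
def Fresh (z : 𝒳) (X : Finset 𝒳) (t u : PreTerm Sg) : Prop :=
  z ∉ t.fv ∪ X ∪ u.fv

/-- One application of a rule of core CPO, all comparisons in the premises being taken in `R`.
`tyGt` is the ordering on types, `prec f g` the precedence `f ≥ g`, and `stat` the status. -/
inductive Rule (tyGt : Ty 𝒮 → Ty 𝒮 → Prop) (prec : ℱ → ℱ → Prop) (stat : ℱ → Status)
    (R : Finset 𝒳 → PreTerm Sg → PreTerm Sg → Prop) :
    Finset 𝒳 → PreTerm Sg → PreTerm Sg → Prop
  -- left-hand side headed by a function symbol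
  | fnSub {X : Finset 𝒳} {f : ℱ} {ts : Fin (Sg.ar f) → PreTerm Sg} {v : PreTerm Sg}
      (i : Fin (Sg.ar f)) :
      Relation.ReflGen (Tau tyGt R ∅) (ts i) v →
      Rule tyGt prec stat R X (.fn f ts) v
  | fnEq {X : Finset 𝒳} {f g : ℱ} {ts : Fin (Sg.ar f) → PreTerm Sg}
      {us : Fin (Sg.ar g) → PreTerm Sg} :
      prec f g → prec g f →
      (∀ i, R X (.fn f ts) (us i)) →
      StatusExt (Tau tyGt R ∅) (stat f) (List.ofFn ts) (List.ofFn us) →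
      Rule tyGt prec stat R X (.fn f ts) (.fn g us)
  | fnGt {X : Finset 𝒳} {f g : ℱ} {ts : Fin (Sg.ar f) → PreTerm Sg}
      {us : Fin (Sg.ar g) → PreTerm Sg} :
      prec f g → ¬ prec g f →
      (∀ i, R X (.fn f ts) (us i)) →
      Rule tyGt prec stat R X (.fn f ts) (.fn g us)
  | fnApp {X : Finset 𝒳} {f : ℱ} {ts : Fin (Sg.ar f) → PreTerm Sg} {u v : PreTerm Sg} :
      R X (.fn f ts) u → R X (.fn f ts) v →
      Rule tyGt prec stat R X (.fn f ts) (.app u v)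
  | fnLam {X : Finset 𝒳} {f : ℱ} {ts : Fin (Sg.ar f) → PreTerm Sg} {B : Ty 𝒮}
      {v : PreTerm Sg} (z : 𝒳) :
      Fresh z X (.fn f ts) (.lam B v) → Sg.varTy z = B →
      R (insert z X) (.fn f ts) (v.inst (.fvar z)) →
      Rule tyGt prec stat R X (.fn f ts) (.lam B v)
  | fnVar {X : Finset 𝒳} {f : ℱ} {ts : Fin (Sg.ar f) → PreTerm Sg} {y : 𝒳} :
      y ∈ X → Rule tyGt prec stat R X (.fn f ts) (.fvar y)
  -- left-hand side an application
  | appSubLeft {X : Finset 𝒳} {t u v : PreTerm Sg} :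
      Relation.ReflGen (R X) t v → Rule tyGt prec stat R X (.app t u) v
  | appSubRight {X : Finset 𝒳} {t u v : PreTerm Sg} :
      Relation.ReflGen (Tau tyGt R X) u v → Rule tyGt prec stat R X (.app t u) v
  | appEqLeft {X : Finset 𝒳} {t u u' : PreTerm Sg} :
      R X u u' → Rule tyGt prec stat R X (.app t u) (.app t u')
  | appEq {X : Finset 𝒳} {t u t' u' : PreTerm Sg} :
      AppGt tyGt R X t u t' → AppGt tyGt R X t u u' →
      Rule tyGt prec stat R X (.app t u) (.app t' u')
  | appLam {X : Finset 𝒳} {t u : PreTerm Sg} {B : Ty 𝒮} {v : PreTerm Sg} (z : 𝒳) :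
      Fresh z X (.app t u) (.lam B v) → Sg.varTy z = B →
      R X (.app t u) (v.inst (.fvar z)) →
      Rule tyGt prec stat R X (.app t u) (.lam B v)
  | appVar {X : Finset 𝒳} {t u : PreTerm Sg} {y : 𝒳} :
      y ∈ X → Rule tyGt prec stat R X (.app t u) (.fvar y)
  | appBeta {X : Finset 𝒳} {A : Ty 𝒮} {b u v : PreTerm Sg} :
      Relation.ReflGen (R X) (b.inst u) v →
      Rule tyGt prec stat R X (.app (.lam A b) u) v
  -- left-hand side an abstraction
  | lamSub {X : Finset 𝒳} {A : Ty 𝒮} {b v : PreTerm Sg} (z : 𝒳) :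
      Fresh z X (.lam A b) v → Sg.varTy z = A →
      Relation.ReflGen (Tau tyGt R X) (b.inst (.fvar z)) v →
      Rule tyGt prec stat R X (.lam A b) v
  | lamEq {X : Finset 𝒳} {A : Ty 𝒮} {b v : PreTerm Sg} (z : 𝒳) :
      Fresh z X (.lam A b) (.lam A v) → Sg.varTy z = A →
      R X (b.inst (.fvar z)) (v.inst (.fvar z)) →
      Rule tyGt prec stat R X (.lam A b) (.lam A v)
  | lamNe {X : Finset 𝒳} {A B : Ty 𝒮} {b v : PreTerm Sg} (z : 𝒳) :
      Fresh z X (.lam A b) (.lam B v) → A ≠ B → Sg.varTy z = B →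
      R X (.lam A b) (v.inst (.fvar z)) →
      Rule tyGt prec stat R X (.lam A b) (.lam B v)
  | lamVar {X : Finset 𝒳} {A : Ty 𝒮} {b : PreTerm Sg} {y : 𝒳} :
      y ∈ X → Rule tyGt prec stat R X (.lam A b) (.fvar y)
  -- `lam A b` is `λ x (t x)` with `x` not free in `t`; here `x` is named `z`
  | lamEta {X : Finset 𝒳} {A : Ty 𝒮} {b t v : PreTerm Sg} (z : 𝒳) :
      z ∉ b.fv → Sg.varTy z = A → b.inst (.fvar z) = .app t (.fvar z) → z ∉ t.fv →
      Relation.ReflGen (R X) t v →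
      Rule tyGt prec stat R X (.lam A b) v

theorem Rule.mono {tyGt : Ty 𝒮 → Ty 𝒮 → Prop} {prec : ℱ → ℱ → Prop} {stat : ℱ → Status}
    {R R' : Finset 𝒳 → PreTerm Sg → PreTerm Sg → Prop}
    (h : ∀ X t u, R X t u → R' X t u) {X : Finset 𝒳} {t u : PreTerm Sg}
    (H : Rule tyGt prec stat R X t u) : Rule tyGt prec stat R' X t u := by
  have hr : ∀ {r s : PreTerm Sg → PreTerm Sg → Prop}, (∀ a b, r a b → s a b) →
      ∀ {a b}, Relation.ReflGen r a b → Relation.ReflGen s a b := by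
    intro r s hrs a b H
    cases H with
    | refl => exact .refl
    | single H => exact .single (hrs _ _ H)
  have hA : ∀ {X t u v}, AppGt tyGt R X t u v → AppGt tyGt R' X t u v := fun H =>
    H.imp (Tau.mono h _ _) (Or.imp (hr (Tau.mono h)) (Tau.mono h _ _))
  cases H with
  | fnSub i h1 => exact .fnSub i (hr (Tau.mono h) h1)
  | fnEq h1 h2 h3 h4 => exact .fnEq h1 h2 (fun i => h _ _ _ (h3 i)) (h4.mono (Tau.mono h))
  | fnGt h1 h2 h3 => exact .fnGt h1 h2 (fun i => h _ _ _ (h3 i))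
  | fnApp h1 h2 => exact .fnApp (h _ _ _ h1) (h _ _ _ h2)
  | fnLam z h1 h2 h3 => exact .fnLam z h1 h2 (h _ _ _ h3)
  | fnVar h1 => exact .fnVar h1
  | appSubLeft h1 => exact .appSubLeft (hr (h _) h1)
  | appSubRight h1 => exact .appSubRight (hr (Tau.mono h) h1)
  | appEqLeft h1 => exact .appEqLeft (h _ _ _ h1)
  | appEq h1 h2 => exact .appEq (hA h1) (hA h2)
  | appLam z h1 h2 h3 => exact .appLam z h1 h2 (h _ _ _ h3)
  | appVar h1 => exact .appVar h1
  | appBeta h1 => exact .appBeta (hr (h _) h1)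
  | lamSub z h1 h2 h3 => exact .lamSub z h1 h2 (hr (Tau.mono h) h3)
  | lamEq z h1 h2 h3 => exact .lamEq z h1 h2 (h _ _ _ h3)
  | lamNe z h1 h2 h3 h4 => exact .lamNe z h1 h2 h3 (h _ _ _ h4)
  | lamVar h1 => exact .lamVar h1
  | lamEta z h1 h2 h3 h4 h5 => exact .lamEta z h1 h2 h3 h4 (hr (h _) h5)

/-- `Gt tyGt prec stat X t u` is the relation `t >^X u` of core CPO: the least family of relations
closed under the rules, for all finite sets `X` of variables simultaneously. -/
def Gt (tyGt : Ty 𝒮 → Ty 𝒮 → Prop) (prec : ℱ → ℱ → Prop) (stat : ℱ → Status) :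
    Finset 𝒳 → PreTerm Sg → PreTerm Sg → Prop :=
  OrderHom.lfp
    (⟨Rule tyGt prec stat, fun _ _ h _ _ _ H => Rule.mono (fun X t u => h X t u) H⟩ :
      (Finset 𝒳 → PreTerm Sg → PreTerm Sg → Prop) →o
        (Finset 𝒳 → PreTerm Sg → PreTerm Sg → Prop))

/-- The core computability path relation `t >_τ u` (with the empty set of variables) on terms. -/
def CoreCPO (tyGt : Ty 𝒮 → Ty 𝒮 → Prop) (prec : ℱ → ℱ → Prop) (stat : ℱ → Status)
    (t u : Term Sg) : Prop :=
  Tau tyGt (Gt tyGt prec stat) ∅ t.1 u.1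

end Core

end CPO

/-!
The proof is a reducibility argument in the style of Tait and Girard.

A predicate `Comp` of computability is defined by recursion on types along `(> ∪ ⊳ₗ)⁺`: a term of
arrow type is computable if it maps computable arguments to computable results, and a term whose
type is a sort is computable if all its `>_τ`-reducts are. A reduct may have a smaller type than the
term it comes from, which is why the recursion also follows the ordering on types, and why
computability at a sort refers to computability at smaller types, arrow types included.

By induction on the type, `good` shows simultaneously that computable terms are accessible for
`>_τ`, that reducts of computable terms are computable, that a term other than an abstraction is
computable if its reducts are, and that an abstraction is computable if the instances of its body
by computable terms are. The arrow case rests on admissibility: if `A ⟶ B > V`, then either `B ≥ V`,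
or `V = A ⟶ B'` with `B > B'`, so that a decrease `t >_τ u` at an arrow type always yields a decrease
of `t a` to `u` or to `u a`. The rules that go under an abstraction on the right-hand side replace its
bound variable by a fresh one; since the relation is stable under substitution (`Gt.subst`), that
variable may afterwards be replaced by an arbitrary computable term.

An application `f(ts)` of a symbol to computable terms is computable (`comp_fn`), by induction on `f`
in the precedence and, among equivalent symbols, on `ts` in the status extension of `>_τ`, which is
well-founded on accessible terms. The parameter `X` of the relation collects the fresh variables
introduced on the way, which are to be replaced by computable terms. Hence every term is computable
(`comp_subst`) and therefore accessible.
-/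

namespace CPO

universe u v w

/-! ### Substitution of free variables and typing -/

namespace PreTerm

variable {𝒮 : Type u} {ℱ : Type v} {𝒳 : Type w} {Sg : Signature 𝒮 ℱ 𝒳}

/-- Simultaneous substitution of the free variables. It is capture-avoiding as soon as every `σ x`
is locally closed, which is the case for the well-typed substitutions `WellTypedSubst`. -/
def subst (σ : 𝒳 → PreTerm Sg) : PreTerm Sg → PreTerm Sg
  | bvar i => bvar i
  | fvar x => σ x
  | fn f ts => fn f fun i => subst σ (ts i)
  | app t u => app (subst σ t) (subst σ u)
  | lam A b => lam A (subst σ b)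

/-- A substitution that maps every variable to a (locally closed) term of the same type. -/
def WellTypedSubst (σ : 𝒳 → PreTerm Sg) : Prop :=
  ∀ x, HasType [] (σ x) (Sg.varTy x)

/-- The number of nodes of a raw term. -/
def size : PreTerm Sg → ℕ
  | bvar _ => 1
  | fvar _ => 1
  | fn _ ts => 1 + ∑ i, size (ts i)
  | app t u => 1 + size t + size u
  | lam _ b => 1 + size b

theorem fv_lam [DecidableEq 𝒳] (A : Ty 𝒮) (b : PreTerm Sg) : (lam A b).fv = b.fv := rfl

theorem size_instAt_fvar (z : 𝒳) (t : PreTerm Sg) :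
    ∀ k, (instAt (.fvar z) k t).size = t.size := by
  induction t with
  | bvar i => intro k; simp only [instAt]; split <;> rfl
  | fvar x => intro k; rfl
  | fn f ts ih => intro k; simp [instAt, size, ih]
  | app t u iht ihu => intro k; simp [instAt, size, iht, ihu]
  | lam A b ih => intro k; simp [instAt, size, ih]

theorem subst_fvar (t : PreTerm Sg) : t.subst .fvar = t := by
  induction t with
  | bvar i => rfl
  | fvar x => rfl
  | fn f ts ih => simp [subst, ih]
  | app t u iht ihu => simp [subst, iht, ihu]
  | lam A b ih => simp [subst, ih]

theorem HasType.unique {Γ : List (Ty 𝒮)} {t : PreTerm Sg} {T U : Ty 𝒮} (h : HasType Γ t T)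
    (h' : HasType Γ t U) : T = U := by
  have arrows_inj : ∀ (l l' : List (Ty 𝒮)) (V W : Ty 𝒮), l.length = l'.length →
      Ty.arrows l V = Ty.arrows l' W → V = W := by
    intro l
    induction l with
    | nil => intro l' V W hl e; cases l' <;> simp_all [Ty.arrows]
    | cons a l ih =>
      intro l' V W hl e
      cases l' with
      | nil => simp at hl
      | cons b l' =>
        simp only [Ty.arrows, Ty.arrow.injEq] at e
        exact ih l' V W (by simpa using hl) e.2
  induction h generalizing U with
  | bvar h => cases h' with | bvar h2 => exact Option.some.inj (h.symm.trans h2)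
  | fvar x => cases h'; rfl
  | fn h _ _ =>
    cases h' with
    | fn h2 _ => exact arrows_inj _ _ _ _ (by simp) (h.symm.trans h2)
  | app _ _ ih1 _ => cases h' with | app h3 _ => exact (Ty.arrow.inj (ih1 h3)).2
  | lam _ ih => cases h' with | lam h2 => rw [ih h2]

theorem HasType.weaken {Γ : List (Ty 𝒮)} {t : PreTerm Sg} {T : Ty 𝒮} (h : HasType Γ t T)
    (Δ : List (Ty 𝒮)) : HasType (Γ ++ Δ) t T := by
  induction h with
  | bvar h =>
    refine .bvar ?_
    rw [List.getElem?_append_left (List.getElem?_eq_some_iff.1 h).1]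
    exact h
  | fvar x => exact .fvar x
  | fn h _ ih => exact .fn h ih
  | app _ _ ih1 ih2 => exact .app ih1 ih2
  | lam _ ih => exact .lam ih

theorem HasType.instAt_eq {Γ : List (Ty 𝒮)} {t : PreTerm Sg} {T : Ty 𝒮} (h : HasType Γ t T)
    (u : PreTerm Sg) : ∀ k, Γ.length ≤ k → instAt u k t = t := by
  induction h with
  | bvar h =>
    intro k hk
    have := (List.getElem?_eq_some_iff.1 h).1
    simp only [instAt]
    rw [if_neg (by omega)]
  | fvar x => intro k hk; rfl
  | fn h _ ih => intro k hk; simp only [instAt]; congr 1; funext i; exact ih i k hk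
  | app _ _ ih1 ih2 => intro k hk; simp only [instAt]; rw [ih1 k hk, ih2 k hk]
  | lam _ ih => intro k hk; simp only [instAt]; rw [ih (k + 1) (by simpa using hk)]

theorem HasType.instAt {A : Ty 𝒮} {u : PreTerm Sg} (hu : HasType [] u A) {Γ : List (Ty 𝒮)}
    {b : PreTerm Sg} {B : Ty 𝒮} (h : HasType (Γ ++ [A]) b B) :
    HasType Γ (instAt u Γ.length b) B := by
  generalize hΔ : Γ ++ [A] = Δ at h
  induction h generalizing Γ with
  | @bvar Δ i T h =>
    subst hΔ
    simp only [PreTerm.instAt]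
    split
    · next hi =>
      subst hi
      simp at h
      subst h
      exact hu.weaken Γ
    · next hi =>
      have h1 := (List.getElem?_eq_some_iff.1 h).1
      simp at h1
      rw [List.getElem?_append_left (by omega)] at h
      exact .bvar h
  | fvar x => exact .fvar x
  | fn h _ ih => exact .fn h fun i => ih i hΔ
  | app _ _ ih1 ih2 => exact .app (ih1 hΔ) (ih2 hΔ)
  | @lam Δ A' B' b _ ih => exact .lam (ih (Γ := A' :: Γ) (by rw [← hΔ]; rfl))

theorem HasType.inst {A B : Ty 𝒮} {b u : PreTerm Sg} (h : HasType [A] b B)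
    (hu : HasType [] u A) : HasType [] (b.inst u) B :=
  HasType.instAt (Γ := []) hu h

theorem HasType.subst {σ : 𝒳 → PreTerm Sg} (hσ : WellTypedSubst σ) {Γ : List (Ty 𝒮)}
    {t : PreTerm Sg} {T : Ty 𝒮} (h : HasType Γ t T) : HasType Γ (t.subst σ) T := by
  induction h with
  | bvar h => exact .bvar h
  | fvar x => exact (hσ x).weaken _
  | fn h _ ih => exact .fn h ih
  | app _ _ ih1 ih2 => exact .app ih1 ih2
  | lam _ ih => exact .lam ih

theorem subst_instAt {σ : 𝒳 → PreTerm Sg} (hσ : WellTypedSubst σ) (u b : PreTerm Sg) :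
    ∀ k, (instAt u k b).subst σ = instAt (u.subst σ) k (b.subst σ) := by
  induction b with
  | bvar i => intro k; simp only [instAt, subst]; split <;> rfl
  | fvar x => intro k; exact ((hσ x).instAt_eq _ k (Nat.zero_le k)).symm
  | fn f ts ih => intro k; simp [instAt, subst, ih]
  | app t u iht ihu => intro k; simp [instAt, subst, iht, ihu]
  | lam A b ih => intro k; simp [instAt, subst, ih]

theorem subst_inst {σ : 𝒳 → PreTerm Sg} (hσ : WellTypedSubst σ) (b u : PreTerm Sg) :
    (b.inst u).subst σ = (b.subst σ).inst (u.subst σ) :=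
  subst_instAt hσ u b 0

theorem wellTypedSubst_fvar : WellTypedSubst (Sg := Sg) .fvar := fun x => .fvar x

variable [DecidableEq 𝒳]

theorem WellTypedSubst.update {σ : 𝒳 → PreTerm Sg} (hσ : WellTypedSubst σ) {z : 𝒳}
    {a : PreTerm Sg} (ha : HasType [] a (Sg.varTy z)) :
    WellTypedSubst (Function.update σ z a) := by
  intro x
  by_cases hx : x = z
  · subst hx; simpa using ha
  · simpa [hx] using hσ x

theorem subst_update (σ : 𝒳 → PreTerm Sg) {z : 𝒳} (a : PreTerm Sg) {t : PreTerm Sg}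
    (hz : z ∉ t.fv) : t.subst (Function.update σ z a) = t.subst σ := by
  induction t with
  | bvar i => rfl
  | fvar x =>
    have : x ≠ z := fun h => hz (by simp [fv, h])
    simp [subst, this]
  | fn f ts ih =>
    simp only [subst]
    congr 1
    funext i
    exact ih i fun h => hz (by simp only [fv, Finset.mem_biUnion]; exact ⟨i, by simp, h⟩)
  | app t u iht ihu =>
    simp only [fv, Finset.mem_union, not_or] at hz
    simp only [subst, iht hz.1, ihu hz.2]
  | lam A b ih => simp only [subst, ih hz]

/-- Substituting the variable `z` that opens an abstraction body amounts to instantiating the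
substituted body. -/
theorem subst_update_inst {σ : 𝒳 → PreTerm Sg} (hσ : WellTypedSubst σ) {z : 𝒳}
    {a b : PreTerm Sg} (ha : HasType [] a (Sg.varTy z)) (hz : z ∉ b.fv) :
    (b.inst (.fvar z)).subst (Function.update σ z a) = (b.subst σ).inst a := by
  rw [subst_inst (hσ.update ha), subst_update σ a hz]
  simp [subst]

theorem subst_single_inst {z : 𝒳} {a b : PreTerm Sg} (ha : HasType [] a (Sg.varTy z))
    (hz : z ∉ b.fv) :
    (b.inst (.fvar z)).subst (Function.update .fvar z a) = b.inst a := by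
  rw [subst_update_inst wellTypedSubst_fvar ha hz, subst_fvar]

end PreTerm

open PreTerm

/-! ### Stability of core CPO under substitution -/

section Stability

variable {𝒮 : Type u} {ℱ : Type v} {𝒳 : Type w} {Sg : Signature 𝒮 ℱ 𝒳}

theorem Signature.exists_var (Sg : Signature 𝒮 ℱ 𝒳) (T : Ty 𝒮) (s : Finset 𝒳) :
    ∃ z, z ∉ s ∧ Sg.varTy z = T := by
  obtain ⟨z, hz, hs⟩ := (Sg.infinite_varTy T).exists_notMem_finset s
  exact ⟨z, hs, hz⟩

theorem reflGen_mono_map {α β : Type*} {r : α → α → Prop} {s : β → β → Prop} {f : α → β}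
    (h : ∀ a b, r a b → s (f a) (f b)) {a b : α} (H : Relation.ReflGen r a b) :
    Relation.ReflGen s (f a) (f b) := by
  cases H with
  | refl => exact .refl
  | single H => exact .single (h _ _ H)

theorem StatusExt.map {α β : Type u} {r : α → α → Prop} {s : β → β → Prop} {f : α → β}
    (h : ∀ a b, r a b → s (f a) (f b)) {st : Status} {ts us : List α}
    (H : StatusExt r st ts us) : StatusExt s st (ts.map f) (us.map f) := by
  cases st with
  | mul =>
    simp only [StatusExt, ← Multiset.map_coe] at H ⊢
    refine Relation.TransGen.lift (p := MulStep s) (Multiset.map f) ?_ _ _ H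
    rintro M N ⟨P, x, Q, rfl, rfl, hQ⟩
    refine ⟨P.map f, f x, Q.map f, by simp, by simp, ?_⟩
    intro y hy
    obtain ⟨q, hq, rfl⟩ := Multiset.mem_map.1 hy
    exact h _ _ (hQ q hq)
  | lex n hn =>
    obtain ⟨j, hj, a, b, h1, h2, h3, h4⟩ := H
    exact ⟨j, hj, f a, f b, by simp [h1], by simp [h2], h _ _ h3, fun i hi => by simp [h4 i hi]⟩

variable [DecidableEq 𝒳]
variable {tyGt : Ty 𝒮 → Ty 𝒮 → Prop} {prec : ℱ → ℱ → Prop} {stat : ℱ → Status}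

theorem Gt.intro {X : Finset 𝒳} {t u : PreTerm Sg}
    (h : Rule tyGt prec stat (Gt tyGt prec stat) X t u) : Gt tyGt prec stat X t u := by
  unfold Gt at h ⊢
  rw [← OrderHom.map_lfp]
  exact h

/-- Rule induction for core CPO; in the premises of the rules, both the relation and the
induction hypothesis are available. -/
theorem Gt.induct {P : Finset 𝒳 → PreTerm Sg → PreTerm Sg → Prop}
    (h : ∀ X t u, Rule tyGt prec stat (fun X t u => Gt tyGt prec stat X t u ∧ P X t u) X t u →
      P X t u) {X : Finset 𝒳} {t u : PreTerm Sg} (H : Gt tyGt prec stat X t u) : P X t u := by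
  have : Gt tyGt prec stat ≤ fun X t u => Gt tyGt prec stat X t u ∧ P X t u :=
    OrderHom.lfp_le _ fun X t u hr => ⟨Gt.intro (hr.mono fun _ _ _ H => H.1), h X t u hr⟩
  exact (this X t u H).2

theorem not_gt_fvar {X : Finset 𝒳} {x : 𝒳} {u : PreTerm Sg} :
    ¬ Gt tyGt prec stat X (.fvar x) u := by
  intro H
  generalize ht : PreTerm.fvar x = t at H
  revert ht
  refine Gt.induct (P := fun _ t _ => PreTerm.fvar x = t → False) ?_ H
  intro X t u hr ht
  subst ht
  cases hr

/-- Core CPO is stable under well-typed substitutions. A substitution may map the variables of the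
parameter `X` only to variables of the new parameter `Y`; this generality lets the fresh variables
of a derivation be renamed within the induction. -/
theorem Gt.subst {X : Finset 𝒳} {t u : PreTerm Sg} (H : Gt tyGt prec stat X t u)
    {σ : 𝒳 → PreTerm Sg} (hσ : WellTypedSubst σ) {Y : Finset 𝒳}
    (hX : ∀ x ∈ X, ∃ y ∈ Y, σ x = .fvar y) :
    Gt tyGt prec stat Y (t.subst σ) (u.subst σ) := by
  let P : Finset 𝒳 → PreTerm Sg → PreTerm Sg → Prop := fun X t u =>
    ∀ {σ : 𝒳 → PreTerm Sg}, WellTypedSubst σ →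
      ∀ {Y : Finset 𝒳}, (∀ x ∈ X, ∃ y ∈ Y, σ x = .fvar y) →
        Gt tyGt prec stat Y (t.subst σ) (u.subst σ)
  refine Gt.induct (P := P) ?_ H hσ hX
  clear hX hσ Y σ H X t u
  intro X t u hr σ hσ Y hX
  have hTau : ∀ {X Y : Finset 𝒳} {σ : 𝒳 → PreTerm Sg}, WellTypedSubst σ →
      (∀ x ∈ X, ∃ y ∈ Y, σ x = .fvar y) → ∀ a b : PreTerm Sg,
      Tau tyGt (fun X t u => Gt tyGt prec stat X t u ∧ P X t u) X a b →
      Tau tyGt (Gt tyGt prec stat) Y (a.subst σ) (b.subst σ) := by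
    rintro X Y σ hσ hX a b ⟨⟨_, h⟩, T, U, hT, hU, hTU⟩
    exact ⟨h hσ hX, T, U, hT.subst hσ, hU.subst hσ, hTU⟩
  have hE : ∀ x ∈ (∅ : Finset 𝒳), ∃ y ∈ (∅ : Finset 𝒳), σ x = .fvar y := by simp
  have hA : ∀ {t u v : PreTerm Sg},
      AppGt tyGt (fun X t u => Gt tyGt prec stat X t u ∧ P X t u) X t u v →
      AppGt tyGt (Gt tyGt prec stat) Y (t.subst σ) (u.subst σ) (v.subst σ) := fun h =>
    h.imp (hTau hσ hX _ _) (Or.imp (reflGen_mono_map (hTau hσ hX)) (hTau hσ hX _ _))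
  -- Renaming of the fresh variable `z` of a rule to a variable fresh for the instance.
  have hfresh : ∀ {t u : PreTerm Sg} (z : 𝒳), Fresh z X t u →
      ∃ z', Sg.varTy z' = Sg.varTy z ∧ Fresh z' Y (t.subst σ) (u.subst σ) ∧
        z ∉ t.fv ∧ z ∉ u.fv ∧ WellTypedSubst (Function.update σ z (.fvar z')) ∧
        ∀ x ∈ X, ∃ y ∈ Y, Function.update σ z (.fvar z') x = .fvar y := by
    intro t u z hz
    simp only [Fresh, Finset.mem_union, not_or] at hz
    obtain ⟨z', hz', ht⟩ := Sg.exists_var (Sg.varTy z) ((t.subst σ).fv ∪ Y ∪ (u.subst σ).fv)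
    refine ⟨z', ht, hz', hz.1.1, hz.2, hσ.update (ht ▸ .fvar z'), ?_⟩
    intro x hx
    have : x ≠ z := fun h => hz.1.2 (h ▸ hx)
    simpa [this] using hX x hx
  have hfv : ∀ {z z' : 𝒳}, Sg.varTy z' = Sg.varTy z →
      HasType (Sg := Sg) [] (.fvar z') (Sg.varTy z) := fun h => h ▸ .fvar _
  cases hr with
  | fnSub i h => exact .intro (.fnSub i (reflGen_mono_map (hTau hσ hE) h))
  | fnEq h1 h2 h3 h4 =>
    refine .intro (.fnEq h1 h2 (fun i => (h3 i).2 hσ hX) ?_)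
    have := h4.map (f := PreTerm.subst σ) (hTau hσ hE)
    rwa [List.map_ofFn, List.map_ofFn] at this
  | fnGt h1 h2 h3 => exact .intro (.fnGt h1 h2 fun i => (h3 i).2 hσ hX)
  | fnApp h1 h2 => exact .intro (.fnApp (h1.2 hσ hX) (h2.2 hσ hX))
  | @fnLam f ts B v z hz hB h =>
    obtain ⟨z', ht, hf, hz1, hz2, hσ', hX'⟩ := hfresh z hz
    rw [fv_lam] at hz2
    refine .intro (.fnLam z' hf (ht.trans hB) ?_)
    have := h.2 hσ' (Y := insert z' Y) (by
      intro x hx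
      rcases Finset.mem_insert.1 hx with rfl | hx
      · exact ⟨z', by simp, by simp⟩
      · obtain ⟨y, hy, e⟩ := hX' x hx
        exact ⟨y, Finset.mem_insert_of_mem hy, e⟩)
    rwa [subst_update σ _ hz1, subst_update_inst hσ (hfv ht) hz2] at this
  | fnVar h =>
    obtain ⟨y, hy, e⟩ := hX _ h
    simp only [PreTerm.subst, e]
    exact .intro (.fnVar hy)
  | appSubLeft h => exact .intro (.appSubLeft (reflGen_mono_map (fun _ _ h => h.2 hσ hX) h))
  | appSubRight h => exact .intro (.appSubRight (reflGen_mono_map (hTau hσ hX) h))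
  | appEqLeft h => exact .intro (.appEqLeft (h.2 hσ hX))
  | appEq h1 h2 => exact .intro (.appEq (hA h1) (hA h2))
  | appLam z hz hB h =>
    obtain ⟨z', ht, hf, hz1, hz2, hσ', hX'⟩ := hfresh z hz
    rw [fv_lam] at hz2
    refine .intro (.appLam z' hf (ht.trans hB) ?_)
    have := h.2 hσ' hX'
    rwa [subst_update σ _ hz1, subst_update_inst hσ (hfv ht) hz2] at this
  | appVar h =>
    obtain ⟨y, hy, e⟩ := hX _ h
    simp only [PreTerm.subst, e]
    exact .intro (.appVar hy)
  | appBeta h =>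
    refine .intro (.appBeta ?_)
    rw [← subst_inst hσ]
    exact reflGen_mono_map (fun _ _ h => h.2 hσ hX) h
  | lamSub z hz hA h =>
    obtain ⟨z', ht, hf, hz1, hz2, hσ', hX'⟩ := hfresh z hz
    rw [fv_lam] at hz1
    refine .intro (.lamSub z' hf (ht.trans hA) ?_)
    have := reflGen_mono_map (hTau hσ' hX') h
    rwa [subst_update σ _ hz2, subst_update_inst hσ (hfv ht) hz1] at this
  | lamEq z hz hA h =>
    obtain ⟨z', ht, hf, hz1, hz2, hσ', hX'⟩ := hfresh z hz
    rw [fv_lam] at hz1 hz2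
    refine .intro (.lamEq z' hf (ht.trans hA) ?_)
    have := h.2 hσ' hX'
    rwa [subst_update_inst hσ (hfv ht) hz1, subst_update_inst hσ (hfv ht) hz2] at this
  | lamNe z hz hAB hB h =>
    obtain ⟨z', ht, hf, hz1, hz2, hσ', hX'⟩ := hfresh z hz
    rw [fv_lam] at hz2
    refine .intro (.lamNe z' hf hAB (ht.trans hB) ?_)
    have := h.2 hσ' hX'
    rwa [subst_update σ _ hz1, subst_update_inst hσ (hfv ht) hz2] at this
  | lamVar h =>
    obtain ⟨y, hy, e⟩ := hX _ h
    simp only [PreTerm.subst, e]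
    exact .intro (.lamVar hy)
  | @lamEta A b t v z hz hA he ht h =>
    obtain ⟨z', hz', hty⟩ := Sg.exists_var (Sg.varTy z) ((b.subst σ).fv ∪ (t.subst σ).fv)
    simp only [Finset.mem_union, not_or] at hz'
    refine .intro (.lamEta z' hz'.1 (hty.trans hA) ?_ hz'.2
      (reflGen_mono_map (fun _ _ h => h.2 hσ hX) h))
    rw [← subst_update_inst hσ (hfv hty) hz, he]
    simp [PreTerm.subst, subst_update σ _ ht]

end Stability

/-! ### Well-foundedness of the status extensions -/

section StatusWf

variable {α : Type u} {r : α → α → Prop}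

theorem wellFounded_mulStep (h : WellFounded fun b a => r a b) :
    WellFounded fun N M => Relation.TransGen (MulStep r) M N := by
  have : Std.Irrefl fun b a => r a b := ⟨fun a ha => (h.irrefl).irrefl a ha⟩
  have hstep : WellFounded fun N M => MulStep r M N := by
    refine Subrelation.wf ?_ h.cutExpand
    rintro N M ⟨P, x, Q, rfl, rfl, hQ⟩
    exact ⟨Q, x, hQ, by abel⟩
  refine Subrelation.wf ?_ hstep.transGen
  intro N M H
  exact Relation.transGen_swap.1 H

theorem wellFounded_statusExt (h : WellFounded fun b a => r a b) (st : Status) :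
    WellFounded fun us ts : List α => StatusExt r st ts us := by
  cases st with
  | mul => exact InvImage.wf (fun l : List α => (l : Multiset α)) (wellFounded_mulStep h)
  | lex n hn =>
    -- Only the first `n` entries matter; a list is read as a function `Fin n → Option α`.
    have hopt : WellFounded fun q p : Option α => ∃ a b, p = some a ∧ q = some b ∧ r a b := by
      have hsome : ∀ a, Acc (fun q p : Option α => ∃ a b, p = some a ∧ q = some b ∧ r a b)
          (some a) := by
        intro a
        induction a using h.induction with
        | _ a ih =>
          refine ⟨_, ?_⟩
          rintro _ ⟨a', b, e, rfl, hab⟩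
          cases e
          exact ih b hab
      refine ⟨fun p => ⟨_, ?_⟩⟩
      rintro _ ⟨a, b, rfl, rfl, hab⟩
      exact hsome b
    have hlex := Pi.Lex.wellFounded (ι := Fin n) (α := fun _ => Option α) (· < ·)
      (fun _ => hopt)
    refine Subrelation.wf ?_ (InvImage.wf (fun (l : List α) (i : Fin n) => l[(i : ℕ)]?) hlex)
    rintro us ts ⟨j, hj, a, b, h1, h2, h3, h4⟩
    exact ⟨⟨j, hj⟩, fun i hi => (h4 i hi).symm, a, b, h1, h2, h3⟩

/-- If the elements of the first sequence are accessible, so are all the elements compared in a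
status extension: the relation may be restricted to accessible elements. -/
theorem StatusExt.restrict_acc {st : Status} {ts us : List α}
    (hts : ∀ t ∈ ts, Acc (fun b a => r a b) t) (H : StatusExt r st ts us) :
    StatusExt (fun a b => r a b ∧ Acc (fun b a => r a b) a) st ts us := by
  cases st with
  | mul =>
    simp only [StatusExt] at H ⊢
    have key : ∀ M N : Multiset α, MulStep r M N → (∀ t ∈ M, Acc (fun b a => r a b) t) →
        MulStep (fun a b => r a b ∧ Acc (fun b a => r a b) a) M N ∧
          ∀ t ∈ N, Acc (fun b a => r a b) t := by
      rintro M N ⟨P, x, Q, rfl, rfl, hQ⟩ hM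
      have hx : Acc (fun b a => r a b) x := hM x (by simp)
      refine ⟨⟨P, x, Q, rfl, rfl, fun y hy => ⟨hQ y hy, hx⟩⟩, fun t ht => ?_⟩
      rcases Multiset.mem_add.1 ht with ht | ht
      · exact hM t (Multiset.mem_add.2 (.inl ht))
      · exact hx.inv (hQ t ht)
    have hts' : ∀ t ∈ (ts : Multiset α), Acc (fun b a => r a b) t := by simpa using hts
    generalize (ts : Multiset α) = M at H hts'
    generalize (us : Multiset α) = N at H
    induction H using Relation.TransGen.head_induction_on with
    | single h => exact .single (key _ _ h hts').1
    | head h _ ih => exact .head (key _ _ h hts').1 (ih (key _ _ h hts').2)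
  | lex n hn =>
    obtain ⟨j, hj, a, b, h1, h2, h3, h4⟩ := H
    exact ⟨j, hj, a, b, h1, h2, ⟨h3, hts a (List.mem_of_getElem? h1)⟩, h4⟩

/-- Restricted to accessible left-hand sides, every relation is well-founded. -/
theorem wellFounded_restrict_acc (r : α → α → Prop) :
    WellFounded fun b a => r a b ∧ Acc (fun b a => r a b) a := by
  refine ⟨fun a => ?_⟩
  have hacc : ∀ a, Acc (fun b a => r a b) a →
      Acc (fun b a => r a b ∧ Acc (fun b a => r a b) a) a := by
    intro a ha
    induction ha with
    | intro a _ ih => exact ⟨_, fun b hb => ih b hb.1⟩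
  exact ⟨_, fun b hb => hacc b (hb.2.inv hb.1)⟩

end StatusWf

/-! ### Computability -/

section Computability

variable {𝒮 : Type u} {ℱ : Type v} {𝒳 : Type w} {Sg : Signature 𝒮 ℱ 𝒳}
variable {tyGt : Ty 𝒮 → Ty 𝒮 → Prop}

theorem Admissible.gt_arrow (hty : Admissible tyGt) (A B : Ty 𝒮) : tyGt (.arrow A B) B :=
  hty.right_subterm _ _ (.intro A B)

theorem Admissible.gt_of_gt_of_ge (hty : Admissible tyGt) {A B C : Ty 𝒮} (h : tyGt A B)
    (h' : Relation.ReflGen tyGt B C) : tyGt A C := by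
  cases h' with
  | refl => exact h
  | single h' => exact hty.trans _ _ _ h h'

theorem Admissible.ge_of_arrow_ge_arrow (hty : Admissible tyGt) {A B B' : Ty 𝒮}
    (h : Relation.ReflGen tyGt (.arrow A B) (.arrow A B')) : Relation.ReflGen tyGt B B' := by
  cases h with
  | refl => exact .refl
  | single h =>
    rcases hty.arrow _ _ _ h with h | ⟨U', e, h⟩
    · cases h with
      | refl => exact .single (hty.gt_arrow _ _)
      | single h => exact .single (hty.trans _ _ _ h (hty.gt_arrow _ _))
    · cases e; exact .single h

theorem Tau.tyGe {R : Finset 𝒳 → PreTerm Sg → PreTerm Sg → Prop} {X : Finset 𝒳}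
    {t u : PreTerm Sg} {T U : Ty 𝒮} (h : Tau tyGt R X t u) (ht : HasType [] t T)
    (hu : HasType [] u U) : Relation.ReflGen tyGt T U := by
  obtain ⟨-, T', U', ht', hu', h⟩ := h
  rwa [ht.unique ht', hu.unique hu']

variable [DecidableEq 𝒳]

/-- Computability at a type `A` which is a sort, as a least fixpoint: all reducts are computable.
`P` provides computability at the types smaller than `A`. -/
inductive CompBase (gt : Ty 𝒮 → Ty 𝒮 → Prop) (R : PreTerm Sg → PreTerm Sg → Prop) (A : Ty 𝒮)
    (P : ∀ V, gt A V → PreTerm Sg → Prop) : PreTerm Sg → Prop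
  | intro {t : PreTerm Sg} : HasType [] t A →
      (∀ u, R t u → HasType [] u A → CompBase gt R A P u) →
      (∀ u V (h : gt A V), R t u → HasType [] u V → P V h u) → CompBase gt R A P t

/-- `Comp hty prec stat T t` says that `t` is a computable term of type `T`: if `T` is a sort, every
reduct of `t` is computable; if `T` is an arrow type, `t` maps computable terms to computable terms.
A term of type `T` can have reducts of any smaller type, hence the recursion on the well-founded
relation `(> ∪ ⊳ₗ)⁺`. -/
def Comp (hty : Admissible tyGt) (prec : ℱ → ℱ → Prop) (stat : ℱ → Status) :
    Ty 𝒮 → PreTerm Sg → Prop :=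
  hty.wf.fix fun T IH => match T, IH with
    | .base s, IH => CompBase tyGt (Tau tyGt (Gt tyGt prec stat) ∅) (.base s)
        fun V h => IH V (.single (.inl h))
    | .arrow A B, IH => fun t => HasType [] t (.arrow A B) ∧
        ∀ a, IH A (.single (.inr (.intro A B))) a →
          IH B (.single (.inl (hty.gt_arrow A B))) (.app t a)

variable {hty : Admissible tyGt} {prec : ℱ → ℱ → Prop} {stat : ℱ → Status}

theorem comp_base {s : 𝒮} {t : PreTerm Sg} : Comp hty prec stat (.base s) t ↔
    CompBase tyGt (Tau tyGt (Gt tyGt prec stat) ∅) (.base s)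
      (fun V _ => Comp hty prec stat V) t := by
  unfold Comp
  rw [WellFounded.fix_eq]

theorem comp_arrow {A B : Ty 𝒮} {t : PreTerm Sg} : Comp hty prec stat (.arrow A B) t ↔
    HasType [] t (.arrow A B) ∧
      ∀ a, Comp hty prec stat A a → Comp hty prec stat B (.app t a) := by
  unfold Comp
  rw [WellFounded.fix_eq]

theorem Comp.hasType {T : Ty 𝒮} {t : PreTerm Sg} (h : Comp hty prec stat T t) :
    HasType [] t T := by
  cases T with
  | base s => cases comp_base.1 h with | intro h _ _ => exact h
  | arrow A B => exact (comp_arrow.1 h).1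

/-- The properties of computability at the type `T` which are established simultaneously by
induction on `T`. -/
structure Good (hty : Admissible tyGt) (prec : ℱ → ℱ → Prop) (stat : ℱ → Status)
    (Sg : Signature 𝒮 ℱ 𝒳) (T : Ty 𝒮) : Prop where
  acc : ∀ t : PreTerm Sg, Comp hty prec stat T t →
    Acc (fun u t => Tau tyGt (Gt tyGt prec stat) ∅ t u) t
  red : ∀ (t u : PreTerm Sg) V, Comp hty prec stat T t → Tau tyGt (Gt tyGt prec stat) ∅ t u →
    HasType [] u V → Comp hty prec stat V u
  /-- A term that is not an abstraction is computable if its reducts are. -/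
  neutral : ∀ t : PreTerm Sg, HasType [] t T → (∀ A b, t ≠ .lam A b) →
    (∀ u V, Tau tyGt (Gt tyGt prec stat) ∅ t u → HasType [] u V → Comp hty prec stat V u) →
    Comp hty prec stat T t
  abs : ∀ A B (b : PreTerm Sg), T = .arrow A B → HasType [] (.lam A b) T →
    (∀ a, Comp hty prec stat A a → Comp hty prec stat B (b.inst a)) →
    Comp hty prec stat T (.lam A b)

/-- Variables are irreducible, hence computable. -/
theorem Good.comp_fvar {x : 𝒳} (h : Good hty prec stat Sg (Sg.varTy x)) :
    Comp hty prec stat (Sg.varTy x) (.fvar x : PreTerm Sg) :=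
  h.neutral _ (.fvar x) (fun _ _ e => by cases e) fun _ _ H => (not_gt_fvar H.1).elim

theorem Good.exists_comp_fvar {T : Ty 𝒮} (h : Good hty prec stat Sg T) :
    ∃ x : 𝒳, Sg.varTy x = T ∧ Comp hty prec stat T (.fvar x : PreTerm Sg) := by
  obtain ⟨x, -, rfl⟩ := Sg.exists_var T ∅
  exact ⟨x, rfl, h.comp_fvar⟩

/-- Decreasing the function part decreases an application. -/
theorem tau_app_left {t u a : PreTerm Sg} {A B B' : Ty 𝒮}
    (h : Tau tyGt (Gt tyGt prec stat) ∅ t u) (ht : HasType [] t (.arrow A B))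
    (hu : HasType [] u (.arrow A B')) (ha : HasType [] a A) (hB : Relation.ReflGen tyGt B B') :
    Tau tyGt (Gt tyGt prec stat) ∅ (.app t a) (.app u a) :=
  ⟨.intro (.appEq (.inl h) (.inr (.inl .refl))), B, B', .app ht ha, .app hu ha, hB⟩

theorem tau_app_of_tau {t u a : PreTerm Sg} {A B V : Ty 𝒮}
    (h : Tau tyGt (Gt tyGt prec stat) ∅ t u) (ht : HasType [] t (.arrow A B))
    (ha : HasType [] a A) (hu : HasType [] u V) (hB : Relation.ReflGen tyGt B V) :
    Tau tyGt (Gt tyGt prec stat) ∅ (.app t a) u :=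
  ⟨.intro (.appSubLeft (.single h.1)), B, V, .app ht ha, hu, hB⟩

theorem Gt.subst_right {t u : PreTerm Sg} (H : Gt tyGt prec stat ∅ t u)
    {σ : 𝒳 → PreTerm Sg} (hσ : WellTypedSubst σ) (ht : t.subst σ = t) :
    Gt tyGt prec stat ∅ t (u.subst σ) := by
  simpa only [ht] using H.subst hσ (Y := ∅) (by simp)

theorem good_base {s : 𝒮}
    (IH : ∀ V, Relation.TransGen (fun A B => tyGt A B ∨ Ty.LeftSub A B) (.base s) V →
      Good hty prec stat Sg V) : Good hty prec stat Sg (.base s) where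
  acc t h := by
    rw [comp_base] at h
    induction h with
    | @intro t ht _ h2 ih =>
      refine ⟨_, fun u hu => ?_⟩
      obtain ⟨-, T, U, ht', hu', hTU⟩ := id hu
      obtain rfl := ht.unique ht'
      cases hTU with
      | refl => exact ih u hu hu'
      | single hTU => exact (IH U (.single (.inl hTU))).acc u (h2 u U hTU hu hu')
  red t u V h hu hV := by
    rw [comp_base] at h
    cases h with
    | intro ht h1 h2 =>
      cases hu.tyGe ht hV with
      | refl => exact comp_base.2 (h1 u hu hV)
      | single hTU => exact h2 u V hTU hu hV
  neutral t ht _ h :=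
    comp_base.2 (.intro ht (fun u hu hU => comp_base.1 (h u _ hu hU)) fun u V _ hu hV => h u V hu hV)
  abs A B b e := by cases e

section Arrow

variable {A B : Ty 𝒮}
  (IH : ∀ V, Relation.TransGen (fun A B => tyGt A B ∨ Ty.LeftSub A B) (.arrow A B) V →
    Good hty prec stat Sg V)

include IH

theorem good_left : Good hty prec stat Sg A := IH A (.single (.inr (.intro A B)))

theorem good_right : Good hty prec stat Sg B := IH B (.single (.inl (hty.gt_arrow A B)))

theorem arrow_red (t u : PreTerm Sg) (V : Ty 𝒮) (ht : Comp hty prec stat (.arrow A B) t)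
    (htu : Tau tyGt (Gt tyGt prec stat) ∅ t u) (hu : HasType [] u V) :
    Comp hty prec stat V u := by
  obtain ⟨hT, happ⟩ := comp_arrow.1 ht
  have hB := good_right IH
  have hcong : ∀ B', V = .arrow A B' → Relation.ReflGen tyGt B B' → Comp hty prec stat V u := by
    rintro B' rfl hBB'
    refine comp_arrow.2 ⟨hu, fun a ha => ?_⟩
    exact hB.red _ _ _ (happ a ha) (tau_app_left htu hT hu ha.hasType hBB') (.app hu ha.hasType)
  cases htu.tyGe hT hu with
  | refl => exact hcong B rfl .refl
  | single h =>
    rcases hty.arrow _ _ _ h with h' | ⟨B', rfl, h'⟩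
    · obtain ⟨x, -, hx⟩ := (good_left IH).exists_comp_fvar
      exact hB.red _ _ _ (happ _ hx) (tau_app_of_tau htu hT hx.hasType hu h') hu
    · exact hcong B' rfl (.single h')

/-- A decreasing sequence from `t` yields one from `t x`, where `x` is a variable of type `A`, as long
as its members have an arrow type; a member of another type is itself a reduct of such an
application. -/
theorem arrow_acc (t : PreTerm Sg) (ht : Comp hty prec stat (.arrow A B) t) :
    Acc (fun u t => Tau tyGt (Gt tyGt prec stat) ∅ t u) t := by
  obtain ⟨x, -, hx⟩ := (good_left IH).exists_comp_fvar
  have hB := good_right IH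
  obtain ⟨hT, happ⟩ := comp_arrow.1 ht
  have hacc := hB.acc _ (happ _ hx)
  clear ht happ
  generalize hs : PreTerm.app t (.fvar x) = s at hacc
  -- The codomain may decrease along the sequence.
  have key : ∀ B', HasType [] t (.arrow A B') →
      Acc (fun u t => Tau tyGt (Gt tyGt prec stat) ∅ t u) t := by
    clear hT
    induction hacc generalizing t with
    | intro s hs' ih =>
      subst hs
      intro B' hT
      refine ⟨_, fun u htu => ?_⟩
      obtain ⟨-, T, V, hT', hu, hTV⟩ := id htu
      obtain rfl := hT.unique hT'
      have hcong : ∀ B'', V = .arrow A B'' → Relation.ReflGen tyGt B' B'' →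
          Acc (fun u t => Tau tyGt (Gt tyGt prec stat) ∅ t u) u := by
        rintro B'' rfl hBB'
        exact ih _ (tau_app_left htu hT hu hx.hasType hBB') u rfl B'' hu
      cases hTV with
      | refl => exact hcong B' rfl .refl
      | single h =>
        rcases hty.arrow _ _ _ h with h' | ⟨B'', rfl, h'⟩
        · exact hs' _ (tau_app_of_tau htu hT hx.hasType hu h')
        · exact hcong B'' rfl (.single h')
  exact key B hT

/-- A term of arrow type is computable if its reducts are and, in case it is an abstraction, if
the instances of its body by computable terms are. -/
theorem arrow_comp (t : PreTerm Sg) (ht : HasType [] t (.arrow A B))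
    (hred : ∀ u V, Tau tyGt (Gt tyGt prec stat) ∅ t u → HasType [] u V →
      Comp hty prec stat V u)
    (hbeta : ∀ A' b, t = .lam A' b → ∀ a, Comp hty prec stat A a →
      Comp hty prec stat B (b.inst a)) :
    Comp hty prec stat (.arrow A B) t := by
  have hA := good_left IH
  have hB := good_right IH
  refine comp_arrow.2 ⟨ht, fun a ha => ?_⟩
  have hacc := hA.acc a ha
  induction hacc with
  | intro a _ iha =>
  -- The substitution `σ` lets the induction pass under the abstractions of the right-hand side.
  have claim : ∀ {X : Finset 𝒳} {s v : PreTerm Sg}, Gt tyGt prec stat X s v → X = ∅ →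
      s = .app t a → ∀ V, HasType [] v V → Relation.ReflGen tyGt B V →
      ∀ σ, WellTypedSubst σ → s.subst σ = s → Comp hty prec stat V (v.subst σ) := by
    intro X s v H
    let P : Finset 𝒳 → PreTerm Sg → PreTerm Sg → Prop := fun X s v => X = ∅ →
      s = .app t a → ∀ V, HasType [] v V → Relation.ReflGen tyGt B V →
      ∀ σ, WellTypedSubst σ → s.subst σ = s → Comp hty prec stat V (v.subst σ)
    refine Gt.induct (P := P) ?_ H
    clear H X s v
    intro X s v hr hX hs V hV hBV σ hσ hsσ
    subst hX hs
    have hta := hsσ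
    simp only [PreTerm.subst, PreTerm.app.injEq] at hta
    obtain ⟨htσ, haσ⟩ := hta
    have hA' : ∀ v V, HasType [] v V →
        AppGt tyGt (fun X t u => Gt tyGt prec stat X t u ∧ P X t u) ∅ t a v →
        Comp hty prec stat V (v.subst σ) := by
      intro v V hV h
      rcases h with h | h | h
      · exact hred _ _ ⟨h.1.1.subst_right hσ htσ, _, _, ht, hV.subst hσ, h.tyGe ht hV⟩
          (hV.subst hσ)
      · cases h with
        | refl => rw [haσ, hV.unique ha.hasType]; exact ha
        | single h =>
          exact hA.red _ _ _ ha ⟨h.1.1.subst_right hσ haσ, _, _, ha.hasType, hV.subst hσ,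
            h.tyGe ha.hasType hV⟩ (hV.subst hσ)
      · exact h.1.2 rfl rfl V hV (h.tyGe (.app ht ha.hasType) hV) σ hσ hsσ
    cases hr with
    | appSubLeft h =>
      have hV' := hty.gt_of_gt_of_ge (hty.gt_arrow A B) hBV
      cases h with
      | refl =>
        rw [hV.unique ht] at hV'
        exact (hty.irrefl _ hV').elim
      | single h =>
        exact hred _ _ ⟨h.1.subst_right hσ htσ, _, _, ht, hV.subst hσ, .single hV'⟩
          (hV.subst hσ)
    | appSubRight h => exact hA' _ _ hV (.inr (.inl h))
    | appEqLeft h =>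
      cases hV with
      | app h1 h2 =>
        cases h1.unique ht
        have hG : Tau tyGt (Gt tyGt prec stat) ∅ a _ :=
          ⟨h.1.subst_right hσ haσ, A, A, ha.hasType, h2.subst hσ, .refl⟩
        simp only [PreTerm.subst, htσ]
        exact iha _ hG (hA.red _ _ _ ha hG (h2.subst hσ))
    | appEq h1 h2 =>
      cases hV with
      | app hT hU => exact (comp_arrow.1 (hA' _ _ hT h1)).2 _ (hA' _ _ hU h2)
    | @appLam _ _ B' b z hz hzB h =>
      subst hzB
      simp only [Fresh, Finset.mem_union, not_or, fv_lam] at hz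
      have hlam := hV.subst hσ
      cases hV with
      | @lam _ _ V' _ hb =>
        refine (IH _ (.single (.inl (hty.gt_of_gt_of_ge (hty.gt_arrow A B) hBV)))).abs
          _ _ _ rfl hlam fun c hc => ?_
        have := h.2 rfl rfl V' (hb.inst (.fvar z))
          (by
            cases hBV with
            | refl => exact .single (hty.gt_arrow _ _)
            | single h => exact .single (hty.trans _ _ _ h (hty.gt_arrow _ _)))
          _ (hσ.update hc.hasType) (by rw [subst_update σ _ hz.1.1, hsσ])
        rwa [subst_update_inst hσ hc.hasType hz.2] at this
    | appVar h => simp at h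
    | @appBeta A' b _ _ h =>
      have hb := hbeta A' b rfl a ha
      have hbσ : (b.inst a).subst σ = b.inst a := by
        simp only [PreTerm.subst, PreTerm.lam.injEq, true_and] at htσ
        rw [subst_inst hσ, htσ, haσ]
      cases h with
      | refl => rw [hbσ, hV.unique hb.hasType]; exact hb
      | single h =>
        exact hB.red _ _ _ hb ⟨h.1.subst_right hσ hbσ, _, _, hb.hasType, hV.subst hσ, hBV⟩
          (hV.subst hσ)
  refine hB.neutral _ (.app ht ha.hasType) (fun _ _ e => by cases e) fun u V hu hV => ?_
  have := claim hu.1 rfl rfl V hV (hu.tyGe (.app ht ha.hasType) hV) .fvar wellTypedSubst_fvar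
    (subst_fvar _)
  rwa [subst_fvar] at this

/-- The reducts of the abstraction are shown to be computable by induction on its body, opened with
a variable, in the accessible part of `>_τ`: this handles the comparison of two abstractions of the
same type by their bodies. -/
theorem arrow_abs (b : PreTerm Sg) (hb : HasType [] (.lam A b) (.arrow A B))
    (hinst : ∀ a, Comp hty prec stat A a → Comp hty prec stat B (b.inst a)) :
    Comp hty prec stat (.arrow A B) (.lam A b) := by
  have hA := good_left IH
  have hB := good_right IH
  obtain ⟨x, hx, hxc⟩ := hA.exists_comp_fvar
  have hacc := hB.acc _ (hinst _ hxc)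
  generalize hs : b.inst (.fvar x) = s at hacc
  induction hacc generalizing b with
  | intro s _ ihs =>
  subst hs
  have claim : ∀ {X : Finset 𝒳} {s v : PreTerm Sg}, Gt tyGt prec stat X s v → X = ∅ →
      s = .lam A b → ∀ V, HasType [] v V → Relation.ReflGen tyGt (.arrow A B) V →
      ∀ σ, WellTypedSubst σ → s.subst σ = s → Comp hty prec stat V (v.subst σ) := by
    intro X s v H
    refine Gt.induct (P := fun X s v => X = ∅ →
      s = .lam A b → ∀ V, HasType [] v V → Relation.ReflGen tyGt (.arrow A B) V →
      ∀ σ, WellTypedSubst σ → s.subst σ = s → Comp hty prec stat V (v.subst σ)) ?_ H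
    clear H X s v
    intro X s v hr hX hs V hV hBV σ hσ hsσ
    subst hX hs
    have hbσ := hsσ
    simp only [PreTerm.subst, PreTerm.lam.injEq, true_and] at hbσ
    cases hr with
    | lamSub z hz hzA h =>
      simp only [Fresh, Finset.mem_union, not_or, fv_lam] at hz
      have hzt : HasType (Sg := Sg) [] (.fvar z) (Sg.varTy z) := .fvar z
      have hzc : Comp hty prec stat A (.fvar z : PreTerm Sg) := by
        subst hzA; exact hA.comp_fvar
      have hbz := hinst _ hzc
      have hbzσ : (b.inst (.fvar z)).subst (Function.update σ z (.fvar z)) = b.inst (.fvar z) := by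
        rw [subst_update_inst hσ hzt hz.1.1, hbσ]
      rw [← subst_update σ (.fvar z) hz.2]
      cases h with
      | refl => rw [hbzσ, hV.unique hbz.hasType]; exact hbz
      | single h =>
        exact hB.red _ _ _ hbz ⟨h.1.1.subst_right (hσ.update hzt) hbzσ, _, _, hbz.hasType,
          hV.subst (hσ.update hzt), h.tyGe hbz.hasType hV⟩ (hV.subst (hσ.update hzt))
    | @lamEq _ _ v z hz hzA h =>
      simp only [Fresh, Finset.mem_union, not_or, fv_lam] at hz
      have hlam := hV.subst hσ
      cases hV with
      | @lam _ _ B' _ hv =>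
        have hBB' := hty.ge_of_arrow_ge_arrow hBV
        have hdec : ∀ a, Comp hty prec stat A a →
            Tau tyGt (Gt tyGt prec stat) ∅ (b.inst a) ((v.subst σ).inst a) := by
          intro a ha
          have hat : HasType [] a (Sg.varTy z) := hzA ▸ ha.hasType
          have := h.1.subst (hσ.update hat) (Y := ∅) (by simp)
          rw [subst_update_inst hσ hat hz.1.1, subst_update_inst hσ hat hz.2, hbσ] at this
          exact ⟨this, _, _, (hinst a ha).hasType, (hv.subst hσ).inst ha.hasType, hBB'⟩
        have hvc : ∀ a, Comp hty prec stat A a → Comp hty prec stat B' ((v.subst σ).inst a) :=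
          fun a ha => hB.red _ _ _ (hinst a ha) (hdec a ha) ((hv.subst hσ).inst ha.hasType)
        cases hBV with
        | refl => exact ihs _ (hdec _ hxc) _ hlam hvc rfl
        | single h => exact (IH _ (.single (.inl h))).abs _ _ _ rfl hlam hvc
    | @lamNe _ C _ v z hz hAC hzC h =>
      subst hzC
      simp only [Fresh, Finset.mem_union, not_or, fv_lam] at hz
      have hlam := hV.subst hσ
      cases hV with
      | @lam _ _ V' _ hv =>
        cases hBV with
        | refl => exact (hAC rfl).elim
        | single hBV =>
          refine (IH _ (.single (.inl hBV))).abs _ _ _ rfl hlam fun c hc => ?_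
          have := h.2 rfl rfl V' (hv.inst (.fvar z))
            (.single (hty.trans _ _ _ hBV (hty.gt_arrow _ _)))
            _ (hσ.update hc.hasType) (by simp only [PreTerm.subst, subst_update σ _ hz.1.1, hbσ])
          rwa [subst_update_inst hσ hc.hasType hz.2] at this
    | lamVar h => simp at h
    | @lamEta _ _ t _ z hz hzA he ht h =>
      have hzt : HasType (Sg := Sg) [] (.fvar z) (Sg.varTy z) := .fvar z
      have htT : HasType [] t (.arrow A B) := by
        cases hb with
        | lam hb =>
          have := hb.inst (hzA ▸ hzt)
          rw [he] at this
          cases this with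
          | app h1 h2 =>
            have := h2.unique (hzA ▸ hzt)
            subst this
            exact h1
      -- The instances of the `η`-redex body are the applications of `t`.
      have htc : Comp hty prec stat (.arrow A B) t := by
        refine comp_arrow.2 ⟨htT, fun a ha => ?_⟩
        have hat : HasType [] a (Sg.varTy z) := hzA ▸ ha.hasType
        have := subst_single_inst hat hz
        rw [he] at this
        simp only [PreTerm.subst, subst_update _ _ ht, subst_fvar, Function.update_self] at this
        rw [this]
        exact hinst a ha
      have htσ : t.subst σ = t := by
        have := subst_update_inst hσ hzt hz
        rw [hbσ, he] at this
        simpa only [PreTerm.subst, subst_update _ _ ht, Function.update_self,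
          PreTerm.app.injEq, and_true] using this
      cases h with
      | refl => rw [htσ, hV.unique htT]; exact htc
      | single h =>
        exact arrow_red IH _ _ _ htc ⟨h.1.subst_right hσ htσ, _, _, htT, hV.subst hσ, hBV⟩
          (hV.subst hσ)
  refine arrow_comp IH _ hb (fun u V hu hV => ?_) ?_
  · have := claim hu.1 rfl rfl V hV (hu.tyGe hb hV) .fvar wellTypedSubst_fvar (subst_fvar _)
    rwa [subst_fvar] at this
  · rintro A' b' e a ha
    cases e
    exact hinst a ha

theorem good_arrow : Good hty prec stat Sg (.arrow A B) where
  acc := arrow_acc IH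
  red := arrow_red IH
  neutral t ht hlam hred := arrow_comp IH t ht hred fun A' b e => (hlam A' b e).elim
  abs A' B' b e hb h := by
    cases e
    exact arrow_abs IH b hb h

end Arrow

theorem good (hty : Admissible tyGt) (prec : ℱ → ℱ → Prop) (stat : ℱ → Status)
    (Sg : Signature 𝒮 ℱ 𝒳) (T : Ty 𝒮) : Good hty prec stat Sg T := by
  induction T using hty.wf.induction with
  | _ T IH =>
    cases T with
    | base s => exact good_base IH
    | arrow A B => exact good_arrow IH

end Computability

/-! ### Computability of all terms -/

section AllComputable

variable {𝒮 : Type u} {ℱ : Type v} {𝒳 : Type w} {Sg : Signature 𝒮 ℱ 𝒳} [DecidableEq 𝒳]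
variable {tyGt : Ty 𝒮 → Ty 𝒮 → Prop} (hty : Admissible tyGt)
variable {prec : ℱ → ℱ → Prop} {stat : ℱ → Status}

/-- A well-typed function application is computable if all terms `g us` with computable arguments
are which are smaller in the precedence, or equivalent and with smaller arguments in the status
extension. -/
theorem comp_fn_of_smaller {f : ℱ} {ts : Fin (Sg.ar f) → PreTerm Sg}
    (hts : ∀ i, ∃ T, Comp hty prec stat T (ts i))
    (hgt : ∀ g, prec f g → ¬ prec g f → ∀ us : Fin (Sg.ar g) → PreTerm Sg,
      (∀ i, ∃ T, Comp hty prec stat T (us i)) → ∀ U, HasType [] (.fn g us) U →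
      Comp hty prec stat U (.fn g us))
    (heq : ∀ g, prec f g → prec g f → ∀ us : Fin (Sg.ar g) → PreTerm Sg,
      (∀ i, ∃ T, Comp hty prec stat T (us i)) →
      StatusExt (Tau tyGt (Gt tyGt prec stat) ∅) (stat f) (List.ofFn ts) (List.ofFn us) →
      ∀ U, HasType [] (.fn g us) U → Comp hty prec stat U (.fn g us))
    {T : Ty 𝒮} (hT : HasType [] (.fn f ts) T) : Comp hty prec stat T (.fn f ts) := by
  have hgood := fun T => good hty prec stat Sg T
  -- The type of `v` is not compared with that of `f(ts)`: premises of the rules may have larger types.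
  have claim : ∀ {X : Finset 𝒳} {s v : PreTerm Sg}, Gt tyGt prec stat X s v → s = .fn f ts →
      ∀ V, HasType [] v V → ∀ σ, WellTypedSubst σ → s.subst σ = s →
      (∀ x ∈ X, Comp hty prec stat (Sg.varTy x) (σ x)) → Comp hty prec stat V (v.subst σ) := by
    intro X s v H
    let P : Finset 𝒳 → PreTerm Sg → PreTerm Sg → Prop := fun X s v => s = .fn f ts →
      ∀ V, HasType [] v V → ∀ σ, WellTypedSubst σ → s.subst σ = s →
      (∀ x ∈ X, Comp hty prec stat (Sg.varTy x) (σ x)) → Comp hty prec stat V (v.subst σ)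
    refine Gt.induct (P := P) ?_ H
    clear H X s v
    intro X s v hr hs V hV σ hσ hsσ hX
    subst hs
    have htsσ : ∀ i, (ts i).subst σ = ts i := by
      simp only [PreTerm.subst, PreTerm.fn.injEq, heq_eq_eq, true_and] at hsσ
      exact fun i => congrFun hsσ i
    cases hr with
    | fnSub i h =>
      obtain ⟨U, hU⟩ := hts i
      cases h with
      | refl => rw [htsσ i, hV.unique hU.hasType]; exact hU
      | single h =>
        exact (hgood U).red _ _ _ hU ⟨h.1.1.subst_right hσ (htsσ i), _, _, hU.hasType,
          hV.subst hσ, h.tyGe hU.hasType hV⟩ (hV.subst hσ)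
    | @fnEq _ g _ us h1 h2 h3 h4 =>
      have hV' := hV.subst hσ
      cases hV with
      | fn e hus =>
        refine heq g h1 h2 _ (fun i => ⟨_, (h3 i).2 rfl _ (hus i) σ hσ hsσ hX⟩) ?_ V hV'
        have := h4.map (s := Tau tyGt (Gt tyGt prec stat) ∅) (f := PreTerm.subst σ) (by
          rintro a b ⟨⟨h, -⟩, A, B, hA, hB, hAB⟩
          exact ⟨h.subst hσ (by simp), A, B, hA.subst hσ, hB.subst hσ, hAB⟩)
        rwa [List.map_ofFn, List.map_ofFn,
          show PreTerm.subst σ ∘ ts = ts from funext htsσ] at this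
    | @fnGt _ g _ us h1 h2 h3 =>
      have hV' := hV.subst hσ
      cases hV with
      | fn e hus =>
        exact hgt g h1 h2 _ (fun i => ⟨_, (h3 i).2 rfl _ (hus i) σ hσ hsσ hX⟩) V hV'
    | fnApp h1 h2 =>
      cases hV with
      | app hu hv =>
        exact (comp_arrow.1 (h1.2 rfl _ hu σ hσ hsσ hX)).2 _ (h2.2 rfl _ hv σ hσ hsσ hX)
    | @fnLam _ _ B b z hz hzB h =>
      subst hzB
      simp only [Fresh, Finset.mem_union, not_or, fv_lam] at hz
      have hlam := hV.subst hσ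
      cases hV with
      | @lam _ _ V' _ hb =>
        refine (hgood _).abs _ _ _ rfl hlam fun c hc => ?_
        have := h.2 rfl V' (hb.inst (.fvar z)) _ (hσ.update hc.hasType)
          (by rw [subst_update σ _ hz.1.1, hsσ]) (by
            intro x hx
            by_cases hxz : x = z
            · subst hxz; simpa using hc
            · simpa [hxz] using hX x (Finset.mem_of_mem_insert_of_ne hx hxz))
        rwa [subst_update_inst hσ hc.hasType hz.2] at this
    | @fnVar _ _ y hy =>
      rw [hV.unique (.fvar y)]
      exact hX y hy
  refine (hgood T).neutral _ hT (fun _ _ e => by cases e) fun u V hu hV => ?_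
  have := claim hu.1 rfl V hV .fvar wellTypedSubst_fvar (subst_fvar _) (by simp)
  rwa [subst_fvar] at this

/-- A well-typed application of a symbol to computable arguments is computable. -/
theorem comp_fn (prec_trans : ∀ f g h, prec f g → prec g h → prec f h)
    (prec_wf : WellFounded fun g f => prec f g ∧ ¬ prec g f)
    (stat_eq : ∀ f g, prec f g → prec g f → stat f = stat g) (prec_refl : ∀ f, prec f f)
    (f : ℱ) (ts : Fin (Sg.ar f) → PreTerm Sg) (hts : ∀ i, ∃ T, Comp hty prec stat T (ts i))
    (T : Ty 𝒮) (hT : HasType [] (.fn f ts) T) : Comp hty prec stat T (.fn f ts) := by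
  induction f using prec_wf.induction generalizing T with
  | _ f₀ IH =>
  have hwf := wellFounded_statusExt (wellFounded_restrict_acc
    (Tau tyGt (Gt tyGt prec stat) (∅ : Finset 𝒳) : PreTerm Sg → PreTerm Sg → Prop)) (stat f₀)
  -- All symbols equivalent to `f₀` are treated at once, by induction on the list of arguments.
  have key : ∀ l : List (PreTerm Sg), ∀ f, prec f₀ f → prec f f₀ →
      ∀ ts : Fin (Sg.ar f) → PreTerm Sg, List.ofFn ts = l →
      (∀ i, ∃ T, Comp hty prec stat T (ts i)) → ∀ T, HasType [] (.fn f ts) T →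
      Comp hty prec stat T (.fn f ts) := by
    intro l
    induction l using hwf.induction with
    | _ l ihl =>
    intro f h1 h2 ts hl hts T hT
    subst hl
    refine comp_fn_of_smaller hty hts (fun g hfg hgf us hus U hU => ?_)
      (fun g hfg hgf us hus hst U hU => ?_) hT
    · exact IH g ⟨prec_trans _ _ _ h1 hfg, fun h => hgf (prec_trans _ _ _ h h1)⟩ us hus U hU
    · rw [← stat_eq f₀ f h1 h2] at hst
      refine ihl _ (hst.restrict_acc fun t ht => ?_) g (prec_trans _ _ _ h1 hfg)
        (prec_trans _ _ _ hgf h2) us rfl hus U hU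
      obtain ⟨i, rfl⟩ := List.mem_ofFn.1 ht
      obtain ⟨A, hA⟩ := hts i
      exact (good hty prec stat Sg A).acc _ hA
  exact key _ f₀ (prec_refl _) (prec_refl _) ts rfl hts T hT

/-- Every instance of a well-typed term by a computable substitution is computable. -/
theorem comp_subst (prec_trans : ∀ f g h, prec f g → prec g h → prec f h)
    (prec_wf : WellFounded fun g f => prec f g ∧ ¬ prec g f)
    (stat_eq : ∀ f g, prec f g → prec g f → stat f = stat g) (prec_refl : ∀ f, prec f f) (n : ℕ)
    (t : PreTerm Sg) (hn : t.size = n) (T : Ty 𝒮) (hT : HasType [] t T) (σ : 𝒳 → PreTerm Sg)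
    (hσ : ∀ x, Comp hty prec stat (Sg.varTy x) (σ x)) :
    Comp hty prec stat T (t.subst σ) := by
  induction n using Nat.strong_induction_on generalizing t T σ with
  | _ n IH =>
  subst hn
  have hσ' : WellTypedSubst σ := fun x => (hσ x).hasType
  have hTσ := hT.subst hσ'
  cases hT with
  | bvar h => simp at h
  | fvar x => exact hσ x
  | @fn _ f ts Ts _ e hts =>
    refine comp_fn hty prec_trans prec_wf stat_eq prec_refl f _ (fun i => ?_) T hTσ
    refine ⟨Ts i, IH _ ?_ (ts i) rfl _ (hts i) σ hσ⟩
    have := Finset.single_le_sum (f := fun i => (ts i).size) (fun _ _ => Nat.zero_le _)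
      (Finset.mem_univ i)
    simp only [size]
    exact Nat.lt_of_le_of_lt this (by omega)
  | @app _ t u A _ ht hu =>
    exact (comp_arrow.1 (IH _ (by simp only [size]; omega) t rfl _ ht σ hσ)).2 _
      (IH _ (by simp only [size]; omega) u rfl _ hu σ hσ)
  | @lam _ A B b hb =>
    refine (good hty prec stat Sg _).abs _ _ _ rfl hTσ fun a ha => ?_
    obtain ⟨z, hz, rfl⟩ := Sg.exists_var A b.fv
    rw [← subst_update_inst hσ' ha.hasType hz]
    refine IH _ ?_ _ (size_instAt_fvar z b 0) B (hb.inst (.fvar z)) _ fun x => ?_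
    · simp only [size]; omega
    · by_cases hxz : x = z
      · subst hxz; simpa using ha
      · simpa [hxz] using hσ x

end AllComputable

end CPO

theorem mainTheorem1 {𝒮 : Type*} {ℱ : Type*} {𝒳 : Type*} [DecidableEq 𝒳]
    (Sg : CPO.Signature 𝒮 ℱ 𝒳)
    (tyGt : CPO.Ty 𝒮 → CPO.Ty 𝒮 → Prop) (hty : CPO.Admissible tyGt)
    (prec : ℱ → ℱ → Prop)
    (prec_refl : ∀ f, prec f f)
    (prec_trans : ∀ f g h, prec f g → prec g h → prec f h)
    (prec_wf : WellFounded fun g f => prec f g ∧ ¬ prec g f)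
    (stat : ℱ → CPO.Status)
    (stat_eq : ∀ f g, prec f g → prec g f → stat f = stat g) :
    WellFounded fun u t : CPO.Term Sg => CPO.CoreCPO tyGt prec stat t u := by
  have hacc : ∀ t : CPO.Term Sg,
      Acc (fun u t => CPO.Tau tyGt (CPO.Gt tyGt prec stat) ∅ t u) t.1 := by
    rintro ⟨t, T, hT⟩
    have := CPO.comp_subst hty prec_trans prec_wf stat_eq prec_refl _ t rfl T hT .fvar
      fun x => (CPO.good hty prec stat Sg _).comp_fvar
    rw [CPO.PreTerm.subst_fvar] at this
    exact (CPO.good hty prec stat Sg T).acc t this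
  exact ⟨fun t => InvImage.accessible Subtype.val (hacc t)⟩
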